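/- Let $N\ge 0$ and for $1\le i\le N$ let $T_i$ be a tree that is regular of degree $k_i\ge 3$, with graph distance $d_i$. Let $G=T_1\times\cdots\times T_N$ be the Cartesian product: its vertices are the tuples $x=(x_1,\dots,x_N)$ with $x_i$ a vertex of $T_i$, and $x,y$ are adjacent if and only if they differ in exactly one coordinate $i$ and $x_i,y_i$ are adjacent in $T_i$. For $p\in[0,1]$ consider Bernoulli bond percolation on $G$, in which each edge is independently open with probability $p$ and closed with probability $1-p$. Let $\tau_p(x,y)$ be the probability that $x$ and $y$ are joined by a path of open edges, and let $p_c$ be the infimum of all $p\in[0,1]$ for which there is an infinite connected component of open edges with positive probability ($p_c=1$ if there is no such $p$). Then, for all vertices $x,y$ of $G$, $$\tau_{p_c}(x,y)\;\le\;\prod_{i=1}^N (k_i-1)^{-d_i(x_i,y_i)}\;=\;\exp\Bigl[-\sum_{i=1}^N \log(k_i-1)\,d_i(x_i,y_i)\Bigr].$$ -/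

import Mathlib

namespace Percolation

open MeasureTheory ProbabilityTheory

/-- The Cartesian product of a family of graphs: two vertices are adjacent when they differ in
exactly one coordinate `i` and their `i`-th coordinates are adjacent in `T i`. -/
def cartesianProduct {ι : Type*} {V : ι → Type*} (T : ∀ i, SimpleGraph (V i)) :
    SimpleGraph (∀ i, V i) where
  Adj x y := ∃ i, (T i).Adj (x i) (y i) ∧ ∀ j, j ≠ i → x j = y j
  symm := ⟨by
    rintro x y ⟨i, h, h'⟩
    exact ⟨i, h.symm, fun j hj => (h' j hj).symm⟩⟩
  loopless := ⟨by
    rintro x ⟨i, h, _⟩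
    exact (T i).loopless.irrefl _ h⟩

/-- The law of Bernoulli bond percolation on `G` with retention probability `p`: independently for
each edge, the edge is open (`true`) with probability `p` and closed (`false`) with
probability `1 - p`. -/
noncomputable def bondMeasure {V : Type*} (G : SimpleGraph V) (p : unitInterval) :
    Measure (G.edgeSet → Bool) :=
  Measure.infinitePi fun _ => bernoulliMeasure true false p

/-- The random subgraph of `G` made of all vertices and of the open edges. -/
def openSubgraph {V : Type*} (G : SimpleGraph V) (ω : G.edgeSet → Bool) : SimpleGraph V where
  Adj x y := ∃ h : G.Adj x y, ω ⟨s(x, y), h⟩ = true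
  symm := ⟨by
    rintro x y ⟨h, hω⟩
    refine ⟨h.symm, ?_⟩
    rw [← hω]
    congr 2
    exact Sym2.eq_swap⟩
  loopless := ⟨by
    rintro x ⟨h, _⟩
    exact G.loopless.irrefl _ h⟩

/-- The cluster of `x`: all vertices joined to `x` by a path of open edges. -/
def cluster {V : Type*} (G : SimpleGraph V) (ω : G.edgeSet → Bool) (x : V) : Set V :=
  {y | (openSubgraph G ω).Reachable x y}

/-- The two-point function `τ_p(x, y)`: the probability that `x` and `y` are joined by a path of
open edges. -/
noncomputable def twoPoint {V : Type*} (G : SimpleGraph V) (p : unitInterval) (x y : V) : ℝ :=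
  (bondMeasure G p).real {ω | y ∈ cluster G ω x}

/-- The critical probability: the infimum, in the complete lattice `[0, 1]` (so it is `1` when
there is no such `p`), of all `p` for which there is an infinite cluster with positive
probability. -/
noncomputable def criticalProb {V : Type*} (G : SimpleGraph V) : unitInterval :=
  sInf {p | 0 < bondMeasure G p {ω | ∃ x, (cluster G ω x).Infinite}}

end Percolation

/-! The bound is proved below the critical point and carried to it by continuity. Let x ≠ y, let b
be the product of (k_i - 1)^{a_i} with a_i = d_i(x_i, y_i), and let q be the probability that x and
y are joined inside a fixed finite edge set F.

Root each T_i at x_i. Every vertex u of G then has at least b vertices v such that each v_i is a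
descendant of u_i at distance a_i. Isometric embeddings of the trees (`IsTree.exists_isometry`)
carry (x, y) to each such (u, v), so u and v are joined inside a copy of F, again with probability
q.

If b q > 1, iterating from x gives a supercritical branching structure. Its steps are dependent, but
two branches use disjoint edges a bounded time after they separate, and the Harris inequality bounds
the cost of the steps before that. A second moment argument (`bernoulliProduct_chains_pos`) then
yields arbitrarily long chains with positive probability, hence an infinite cluster
(`infinite_cluster_of_one_lt`). So q ≤ 1/b for every p < p_c. As q is a polynomial in p, this
persists at p_c; letting F increase gives the bound on the two-point function. -/

namespace SimpleGraph

/-! ### Geodesics in trees and extension of partial isometries. -/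

variable {V W : Type*} {S : SimpleGraph V} {T : SimpleGraph W}

/-- In a connected graph every vertex `u ≠ v` has a neighbour closer to `v`. -/
theorem Connected.exists_adj_dist_add_one (hS : S.Connected) {u v : V} (h : u ≠ v) :
    ∃ c, S.Adj u c ∧ S.dist c v + 1 = S.dist u v := by
  obtain ⟨p, hp⟩ := hS.exists_walk_length_eq_dist u v
  cases p with
  | nil => exact absurd rfl h
  | @cons _ c _ hadj p =>
    refine ⟨c, hadj, ?_⟩
    rw [Walk.length_cons] at hp
    have h1 := dist_le p
    have h2 := hS.dist_triangle (u := u) (v := c) (w := v)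
    rw [dist_eq_one_iff_adj.2 hadj] at h2
    omega

theorem Adj.dist_le_dist_add_one (hS : S.Connected) {a b : V} (h : S.Adj a b) (r : V) :
    S.dist a r ≤ S.dist b r + 1 := by
  have := hS.dist_triangle (u := a) (v := b) (w := r)
  rw [dist_eq_one_iff_adj.2 h] at this
  omega

/-- In a tree, a vertex has at most one neighbour closer to a given vertex. -/
theorem IsTree.eq_of_adj_of_dist_lt (hS : S.IsTree) {r u a b : V} (ha : S.Adj u a)
    (hb : S.Adj u b) (hda : S.dist a r < S.dist u r) (hdb : S.dist b r < S.dist u r) : a = b := by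
  have key : ∀ {c : V} (hc : S.Adj u c), S.dist c r < S.dist u r →
      ∃ p : S.Walk c r, (Walk.cons hc p).IsPath := by
    intro c hc hd
    obtain ⟨p, hp⟩ := hS.connected.exists_walk_length_eq_dist c r
    refine ⟨p, Walk.isPath_of_length_eq_dist _ ?_⟩
    have := hc.dist_le_dist_add_one hS.connected r
    rw [Walk.length_cons]
    omega
  obtain ⟨p, hp⟩ := key ha hda
  obtain ⟨q, hq⟩ := key hb hdb
  have h := (hS.existsUnique_path u r).unique hp hq
  have := congrArg Walk.snd h
  simpa using this

theorem IsTree.dist_eq_add_one_of_not_lt (hS : S.IsTree) {a b r : V} (h : S.Adj a b)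
    (hlt : ¬ S.dist a r < S.dist b r) : S.dist a r = S.dist b r + 1 := by
  have := hS.dist_eq_dist_add_one_of_adj r h
  rw [dist_comm (u := r), dist_comm (u := r)] at this
  omega

theorem Walk.dist_getVert (p : S.Walk u v) (hS : S.Connected) (hp : p.length = S.dist u v)
    {i j : ℕ} (hij : i ≤ j) (hj : j ≤ p.length) :
    S.dist (p.getVert i) (p.getVert j) = j - i := by
  -- Upper bounds suffice: those for the three pieces of the geodesic add up to the full distance,
  -- so the triangle inequality forces equality.
  have lip : ∀ i j, i ≤ j → j ≤ p.length → S.dist (p.getVert i) (p.getVert j) ≤ j - i := by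
    intro i j hij
    induction j, hij using Nat.le_induction with
    | base => simp
    | succ j hij ih =>
      intro hj
      have h1 := ih (by omega)
      have h2 := (p.adj_getVert_succ (i := j) (by omega)).symm.dist_le_dist_add_one hS
        (p.getVert i)
      rw [dist_comm (v := p.getVert i), dist_comm (v := p.getVert i)] at h2
      omega
  have h1 := lip 0 i (by omega) (by omega)
  have h2 := lip i j hij hj
  have h3 := lip j p.length hj le_rfl
  have h4 := hS.dist_triangle (u := p.getVert 0) (v := p.getVert i) (w := p.getVert p.length)
  have h5 := hS.dist_triangle (u := p.getVert i) (v := p.getVert j) (w := p.getVert p.length)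
  rw [Walk.getVert_zero, Walk.getVert_length] at *
  omega

/-- A set of pairs that is the graph of an isometry between convex sets of vertices. -/
structure IsConvexIsometry (S : SimpleGraph V) (T : SimpleGraph W) (R : Set (V × W)) : Prop where
  dist_eq : ∀ p ∈ R, ∀ q ∈ R, T.dist p.2 q.2 = S.dist p.1 q.1
  convex : ∀ p ∈ R, ∀ q ∈ R, ∀ c, S.Adj p.1 c → S.dist c q.1 < S.dist p.1 q.1 →
    ∃ c', (c, c') ∈ R

theorem IsConvexIsometry.sUnion {c : Set (Set (V × W))} (hc : ∀ R ∈ c, IsConvexIsometry S T R)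
    (hchain : IsChain (· ⊆ ·) c) : IsConvexIsometry S T (⋃₀ c) := by
  have key : ∀ p ∈ ⋃₀ c, ∀ q ∈ ⋃₀ c, ∃ R ∈ c, p ∈ R ∧ q ∈ R := by
    rintro p ⟨R, hR, hp⟩ q ⟨R', hR', hq⟩
    rcases hchain.total hR hR' with h | h
    · exact ⟨R', hR', h hp, hq⟩
    · exact ⟨R, hR, hp, h hq⟩
  constructor
  · intro p hp q hq
    obtain ⟨R, hR, hp, hq⟩ := key p hp q hq
    exact (hc R hR).dist_eq p hp q hq
  · intro p hp q hq d hd hlt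
    obtain ⟨R, hR, hp, hq⟩ := key p hp q hq
    obtain ⟨d', hd'⟩ := (hc R hR).convex p hp q hq d hd hlt
    exact ⟨d', R, hR, hd'⟩

theorem IsTree.exists_isConvexIsometry (hS : S.IsTree) (hT : T.IsTree) {x y : V} {u v : W}
    (h : S.dist x y = T.dist u v) :
    ∃ R, IsConvexIsometry S T R ∧ (x, u) ∈ R ∧ (y, v) ∈ R := by
  obtain ⟨p, hp⟩ := hS.connected.exists_walk_length_eq_dist x y
  obtain ⟨q, hq⟩ := hT.connected.exists_walk_length_eq_dist u v
  have hpq : p.length = q.length := by omega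
  refine ⟨{z | ∃ i ≤ p.length, z = (p.getVert i, q.getVert i)}, ⟨?_, ?_⟩, ⟨0, by simp⟩,
    ⟨p.length, le_rfl, ?_⟩⟩
  · rintro _ ⟨i, hi, rfl⟩ _ ⟨j, hj, rfl⟩
    rcases le_total i j with hij | hij
    · rw [p.dist_getVert hS.connected hp hij hj, q.dist_getVert hT.connected hq hij (by omega)]
    · rw [dist_comm, dist_comm (u := p.getVert i), p.dist_getVert hS.connected hp hij hi,
        q.dist_getVert hT.connected hq hij (by omega)]
  · rintro _ ⟨i, hi, rfl⟩ _ ⟨j, hj, rfl⟩ c hc hlt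
    dsimp only at hc hlt
    rcases lt_trichotomy i j with hij | rfl | hij
    · refine ⟨q.getVert (i + 1), i + 1, by omega, ?_⟩
      rw [hS.eq_of_adj_of_dist_lt hc (p.adj_getVert_succ (i := i) (by omega)) hlt]
      rw [p.dist_getVert hS.connected hp (by omega) hj,
        p.dist_getVert hS.connected hp (by omega) hj]
      omega
    · simp at hlt
    · obtain ⟨i, rfl⟩ : ∃ l, i = l + 1 := ⟨i - 1, by omega⟩
      refine ⟨q.getVert i, i, by omega, ?_⟩
      rw [hS.eq_of_adj_of_dist_lt hc (p.adj_getVert_succ (i := i) (by omega)).symm hlt]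
      rw [dist_comm, dist_comm (v := p.getVert j), p.dist_getVert hS.connected hp (by omega) hi,
        p.dist_getVert hS.connected hp (by omega) (by omega)]
      omega
  · rw [Walk.getVert_length, hpq, Walk.getVert_length]

/-- The degree hypothesis leaves a neighbour `w` of `s'` outside the range. By convexity every
geodesic from `c` into the domain starts through `s`, and likewise from `w` through `s'`, so sending
`c` to `w` preserves distances. -/
theorem IsConvexIsometry.exists_insert [S.LocallyFinite] [T.LocallyFinite] (hS : S.IsTree)
    (hT : T.IsTree) (hdeg : ∀ v w, S.degree v ≤ T.degree w) {R : Set (V × W)}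
    (hR : IsConvexIsometry S T R) {s c : V} {s' : W} (hs : (s, s') ∈ R) (hsc : S.Adj s c)
    (hc : ∀ c', (c, c') ∉ R) : ∃ w, IsConvexIsometry S T (insert (c, w) R) := by
  -- Otherwise preimages would inject the neighbours of `s'` into those of `s` other than `c`, which
  -- are too few.
  obtain ⟨w, hw, hwR⟩ : ∃ w, T.Adj s' w ∧ ∀ t, (t, w) ∉ R := by
    by_contra! hcon
    have : Nonempty V := ⟨s⟩
    choose! f hf using hcon
    classical
    have hmaps : ∀ w ∈ T.neighborFinset s', f w ∈ (S.neighborFinset s).erase c := by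
      intro w hw
      rw [mem_neighborFinset] at hw
      have h1 := hR.dist_eq _ hs _ (hf w hw)
      rw [dist_eq_one_iff_adj.2 hw, eq_comm, dist_eq_one_iff_adj] at h1
      rw [Finset.mem_erase, mem_neighborFinset]
      refine ⟨?_, h1⟩
      rintro rfl
      exact hc w (hf w hw)
    have hinj : Set.InjOn f (T.neighborFinset s') := by
      intro w hw w' hw' hww
      simp only [Finset.mem_coe, mem_neighborFinset] at hw hw'
      have h1 := hR.dist_eq _ (hf w hw) _ (hf w' hw')
      simp only [hww, dist_self] at h1
      exact hT.connected.dist_eq_zero_iff.1 h1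
    have h1 := Finset.card_le_card_of_injOn f hmaps hinj
    rw [Finset.card_erase_of_mem (by simpa using hsc), card_neighborFinset_eq_degree,
      card_neighborFinset_eq_degree] at h1
    have h2 := hdeg s s'
    have h3 : 0 < S.degree s := (S.degree_pos_iff_exists_adj s).2 ⟨c, hsc⟩
    omega
  have hdc : ∀ t t', (t, t') ∈ R → S.dist c t = S.dist s t + 1 := fun t t' ht =>
    hS.dist_eq_add_one_of_not_lt hsc.symm fun hlt => by
      obtain ⟨c', hc'⟩ := hR.convex _ hs _ ht c hsc hlt
      exact hc c' hc'
  -- If `w` were closer to `t'`, it would be the image of the next vertex `z` on the geodesic from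
  -- `s` to `t`, yet `w` is not in the range.
  have hdw : ∀ t t', (t, t') ∈ R → T.dist w t' = T.dist s' t' + 1 := fun t t' ht =>
    hT.dist_eq_add_one_of_not_lt hw.symm fun hlt => by
      have hst := hR.dist_eq _ hs _ ht
      dsimp only at hst
      have hne : s ≠ t := by
        rintro rfl
        rw [dist_self] at hst
        omega
      obtain ⟨z, hsz, hz⟩ := hS.connected.exists_adj_dist_add_one hne
      obtain ⟨z', hz'⟩ := hR.convex _ hs _ ht z hsz (by dsimp only; omega)
      have h1 := hR.dist_eq _ hs _ hz'
      have h2 := hR.dist_eq _ hz' _ ht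
      dsimp only at h1 h2
      rw [dist_eq_one_iff_adj.2 hsz, dist_eq_one_iff_adj] at h1
      have h3 := hT.eq_of_adj_of_dist_lt hw h1 hlt (by omega)
      subst h3
      exact hwR z hz'
  refine ⟨w, ?_, ?_⟩
  · rintro p (rfl | hp) q (rfl | hq)
    · simp
    · rw [hdc _ _ hq, hdw _ _ hq, hR.dist_eq _ hs _ hq]
    · rw [dist_comm, dist_comm (u := p.1), hdc _ _ hp, hdw _ _ hp, hR.dist_eq _ hs _ hp]
    · exact hR.dist_eq _ hp _ hq
  · rintro p (rfl | hp) q (rfl | hq) n hn hlt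
    · simp at hlt
    · refine ⟨s', Or.inr ?_⟩
      rw [hS.eq_of_adj_of_dist_lt hn hsc.symm hlt (by have := hdc _ _ hq; dsimp only; omega)]
      exact hs
    -- A geodesic from the domain to `c` passes through `s`, so its first step either is `c` itself
    -- or heads towards `s`.
    · by_cases hps : p.1 = s
      · refine ⟨w, Or.inl ?_⟩
        dsimp only at hlt
        rw [hps, dist_eq_one_iff_adj.2 hsc, Nat.lt_one_iff,
          hS.connected.dist_eq_zero_iff] at hlt
        rw [hlt]
      · obtain ⟨m, hpm, hm⟩ := hS.connected.exists_adj_dist_add_one hps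
        obtain ⟨m', hm'⟩ := hR.convex _ hp _ hs m hpm (by dsimp only; omega)
        have h1 := hdc _ _ hp
        have h2 := hdc _ _ hm'
        dsimp only at hlt
        rw [dist_comm (v := p.1), dist_comm (v := p.1)] at h1
        rw [dist_comm (v := m), dist_comm (v := m)] at h2
        rw [hS.eq_of_adj_of_dist_lt hn hpm hlt (by omega)]
        exact ⟨m', Or.inr hm'⟩
    · obtain ⟨c', hc'⟩ := hR.convex _ hp _ hq n hn hlt
      exact ⟨c', Or.inr hc'⟩

/-- Two pairs of vertices at equal distance in trees are matched by an isometric embedding, when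
the degrees in the target tree are at least those in the source tree. -/
theorem IsTree.exists_isometry [S.LocallyFinite] [T.LocallyFinite] (hS : S.IsTree)
    (hT : T.IsTree) (hdeg : ∀ v w, S.degree v ≤ T.degree w) {x y : V} {u v : W}
    (h : S.dist x y = T.dist u v) :
    ∃ f : V → W, f x = u ∧ f y = v ∧ ∀ a b, T.dist (f a) (f b) = S.dist a b := by
  obtain ⟨R₀, hR₀, hx, hy⟩ := hS.exists_isConvexIsometry hT h
  obtain ⟨R, hRR, hR⟩ := zorn_subset_nonempty {R | IsConvexIsometry S T R}
    (fun c hc hchain _ => ⟨⋃₀ c, IsConvexIsometry.sUnion hc hchain,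
      fun s hs => Set.subset_sUnion_of_mem hs⟩) R₀ hR₀
  have hiso : IsConvexIsometry S T R := hR.prop
  have htot : ∀ a, ∃ a', (a, a') ∈ R := by
    by_contra! hcon
    obtain ⟨a, ha⟩ := hcon
    obtain ⟨p⟩ := hS.connected x a
    obtain ⟨d, -, ⟨s', hd⟩, hd'⟩ := p.exists_boundary_dart {b | ∃ b', (b, b') ∈ R}
      ⟨u, hRR hx⟩ (by simpa using ha)
    have hd' : ∀ c', (d.snd, c') ∉ R := by simpa using hd'
    obtain ⟨w, hw⟩ := hiso.exists_insert hS hT hdeg hd d.adj hd'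
    exact hd' w (hR.le_of_ge hw (Set.subset_insert _ _) (Set.mem_insert _ _))
  choose f hf using htot
  have huniq : ∀ a b, (a, b) ∈ R → f a = b := by
    intro a b hab
    have := hiso.dist_eq _ (hf a) _ hab
    rw [dist_self] at this
    exact hT.connected.dist_eq_zero_iff.1 this
  exact ⟨f, huniq _ _ (hRR hx), huniq _ _ (hRR hy), fun a b => hiso.dist_eq _ (hf a) _ (hf b)⟩

/-! ### Descendants in a rooted tree. -/

/-- `z` is a descendant of `v` when the tree is rooted at `r`. -/
def IsDescendant (S : SimpleGraph V) (r v z : V) : Prop :=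
  S.dist z r = S.dist v r + S.dist z v

theorem IsDescendant.refl (r v : V) : S.IsDescendant r v v := by simp [IsDescendant]

theorem IsDescendant.trans (hS : S.Connected) {r v w z : V} (h : S.IsDescendant r v w)
    (h' : S.IsDescendant r w z) : S.IsDescendant r v z ∧ S.dist z v = S.dist z w + S.dist w v := by
  unfold IsDescendant at *
  have h1 := hS.dist_triangle (u := z) (v := w) (w := v)
  have h2 := hS.dist_triangle (u := z) (v := v) (w := r)
  omega

/-- Neighbours closer to `v` of a descendant of `v` are closer to the root. -/
theorem IsDescendant.of_adj_of_dist_lt (hS : S.Connected) {r v z t : V}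
    (hz : S.IsDescendant r v z) (ht : S.Adj z t) (hlt : S.dist t v < S.dist z v) :
    S.IsDescendant r v t ∧ S.dist t r < S.dist z r := by
  unfold IsDescendant at *
  have h1 := hS.dist_triangle (u := t) (v := v) (w := r)
  have h2 := ht.dist_le_dist_add_one hS r
  have h3 := ht.dist_le_dist_add_one hS v
  omega

theorem IsTree.isDescendant_of_adj (hS : S.IsTree) {r v z t : V} (hz : S.IsDescendant r v z)
    (ht : S.Adj z t) (hne : z ≠ v) : S.IsDescendant r v t := by
  by_cases hlt : S.dist t r < S.dist z r
  · obtain ⟨c, hc, hcv⟩ := hS.connected.exists_adj_dist_add_one hne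
    have := hz.of_adj_of_dist_lt hS.connected hc (by omega)
    rw [hS.eq_of_adj_of_dist_lt ht hc hlt this.2]
    exact this.1
  · have h1 := hS.dist_eq_add_one_of_not_lt ht.symm hlt
    have h2 := ht.symm.dist_le_dist_add_one hS.connected v
    have h3 := hS.connected.dist_triangle (u := t) (v := v) (w := r)
    unfold IsDescendant at *
    omega

/-- The subtree below `v` can only be left through `v`, and a path no longer than the distance from
`z` to `v` gets no further than `v`. -/
theorem IsTree.isDescendant_of_dist_le (hS : S.IsTree) {r v z z' : V}
    (hz : S.IsDescendant r v z) (h : S.dist z z' ≤ S.dist z v) : S.IsDescendant r v z' := by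
  induction hn : S.dist z z' generalizing z with
  | zero => rwa [hS.connected.dist_eq_zero_iff.1 hn] at hz
  | succ n ih =>
    have hne : z ≠ z' := by rintro rfl; simp at hn
    have hzv : z ≠ v := by rintro rfl; rw [dist_self] at h; omega
    obtain ⟨c, hc, hcz⟩ := hS.connected.exists_adj_dist_add_one hne
    have := hc.dist_le_dist_add_one hS.connected v
    exact ih (hS.isDescendant_of_adj hz hc hzv) (by omega) (by omega)

theorem IsTree.eq_of_isDescendant (hS : S.IsTree) {r v v' z : V} (hz : S.IsDescendant r v z)
    (hz' : S.IsDescendant r v' z) (h : S.dist v r = S.dist v' r) : v = v' := by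
  induction hn : S.dist z v generalizing z with
  | zero =>
    unfold IsDescendant at *
    have h1 : S.dist z v' = 0 := by omega
    rw [hS.connected.dist_eq_zero_iff] at hn h1
    rw [← hn, ← h1]
  | succ n ih =>
    have hd : S.dist z v = S.dist z v' := by unfold IsDescendant at *; omega
    have hne : z ≠ v := by rintro rfl; simp at hn
    have hne' : z ≠ v' := by rintro rfl; rw [dist_self] at hd; omega
    obtain ⟨c, hc, hcv⟩ := hS.connected.exists_adj_dist_add_one hne
    obtain ⟨c', hc', hcv'⟩ := hS.connected.exists_adj_dist_add_one hne'
    have h1 := hz.of_adj_of_dist_lt hS.connected hc (by omega)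
    have h2 := hz'.of_adj_of_dist_lt hS.connected hc' (by omega)
    have := hS.eq_of_adj_of_dist_lt hc hc' h1.2 h2.2
    subst this
    exact ih h1.1 h2.1 (by omega)

/-- Descendants of distinct vertices of the same generation are far apart. -/
theorem IsTree.dist_lt_dist_of_isDescendant (hS : S.IsTree) {r v v' z z' : V}
    (hz : S.IsDescendant r v z) (hz' : S.IsDescendant r v' z') (h : S.dist v r = S.dist v' r)
    (hne : v ≠ v') : S.dist z v < S.dist z z' := by
  by_contra! hle
  exact hne (hS.eq_of_isDescendant (hS.isDescendant_of_dist_le hz hle) hz' h)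

/-- A vertex of a tree of minimal degree at least `k + 1` has at least `k ^ a` descendants `a`
generations below. -/
theorem IsTree.exists_descendants [S.LocallyFinite] (hS : S.IsTree) {k : ℕ}
    (hk : ∀ v, k + 1 ≤ S.degree v) (r u : V) (a : ℕ) :
    ∃ s : Finset V, s.card = k ^ a ∧ ∀ z ∈ s, S.IsDescendant r u z ∧ S.dist z u = a := by
  classical
  have child : ∀ z, ∃ s : Finset V, s.card = k ∧ ∀ c ∈ s, S.Adj z c ∧ S.dist z r < S.dist c r := by
    intro z
    have hcard : k ≤ {c ∈ S.neighborFinset z | S.dist z r < S.dist c r}.card := by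
      have h1 := Finset.card_filter_add_card_filter_not (s := S.neighborFinset z)
        (fun c => S.dist z r < S.dist c r)
      have h2 : {c ∈ S.neighborFinset z | ¬ S.dist z r < S.dist c r}.card ≤ 1 := by
        refine Finset.card_le_one.2 fun c hc d hd => ?_
        simp only [Finset.mem_filter, mem_neighborFinset] at hc hd
        have h3 := hS.dist_eq_add_one_of_not_lt (r := r) hc.1 hc.2
        have h4 := hS.dist_eq_add_one_of_not_lt (r := r) hd.1 hd.2
        exact hS.eq_of_adj_of_dist_lt (r := r) hc.1 hd.1 (by omega) (by omega)
      have h3 := hk z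
      rw [card_neighborFinset_eq_degree] at h1
      omega
    obtain ⟨s, hs, hsk⟩ := Finset.exists_subset_card_eq hcard
    refine ⟨s, hsk, fun c hc => ?_⟩
    simpa using hs hc
  choose ch hch hch' using child
  induction a with
  | zero => exact ⟨{u}, by simp, by simp [IsDescendant.refl]⟩
  | succ a ih =>
    obtain ⟨s, hs, hs'⟩ := ih
    refine ⟨s.biUnion ch, ?_, ?_⟩
    · rw [Finset.card_biUnion, Finset.sum_congr rfl fun z _ => hch z, Finset.sum_const, hs,
        smul_eq_mul, pow_succ]
      intro z hz z' hz' hne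
      refine Finset.disjoint_left.2 fun c hc hc' => hne ?_
      exact hS.eq_of_adj_of_dist_lt (hch' z c hc).1.symm (hch' z' c hc').1.symm (hch' z c hc).2
        (hch' z' c hc').2
    · intro c hc
      obtain ⟨z, hz, hc⟩ := Finset.mem_biUnion.1 hc
      obtain ⟨hadj, hlt⟩ := hch' z c hc
      have h1 : S.IsDescendant r z c := by
        have := hadj.symm.dist_le_dist_add_one hS.connected r
        unfold IsDescendant
        rw [dist_eq_one_iff_adj.2 hadj.symm]
        omega
      have h2 := (hs' z hz).1.trans hS.connected h1
      refine ⟨h2.1, ?_⟩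
      rw [h2.2, (hs' z hz).2, dist_eq_one_iff_adj.2 hadj.symm, add_comm]

theorem Connected.countable [S.LocallyFinite] (hS : S.Connected) : Countable V := by
  obtain ⟨r⟩ := hS.nonempty
  have hfin : ∀ n : ℕ, {z | S.dist z r ≤ n}.Finite := by
    intro n
    induction n with
    | zero =>
      refine (Set.finite_singleton r).subset fun z hz => ?_
      simpa [hS.dist_eq_zero_iff] using hz
    | succ n ih =>
      refine (ih.union (ih.biUnion fun z _ => (S.neighborFinset z).finite_toSet)).subset
        fun z hz => ?_
      by_cases hzr : z = r
      · exact Or.inl (by simp [hzr])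
      · obtain ⟨c, hc, hcr⟩ := hS.exists_adj_dist_add_one hzr
        refine Or.inr (Set.mem_biUnion (x := c) ?_ (by simpa using hc.symm))
        have : S.dist z r ≤ n + 1 := hz
        exact (by omega : S.dist c r ≤ n)
  have : (⋃ n : ℕ, {z | S.dist z r ≤ n}) = Set.univ :=
    Set.eq_univ_of_forall fun z => Set.mem_iUnion.2 ⟨S.dist z r, le_refl (S.dist z r)⟩
  rw [← Set.countable_univ_iff, ← this]
  exact Set.countable_iUnion fun n => (hfin n).countable

end SimpleGraph

/-! ### Product Bernoulli measures: finite events, Harris inequality, independence. -/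

open MeasureTheory ProbabilityTheory

/-- The product of Bernoulli measures over an arbitrary index type. -/
noncomputable abbrev bernoulliProduct (E : Type*) (p : unitInterval) : Measure (E → Bool) :=
  Measure.infinitePi fun _ => bernoulliMeasure true false p

/-- Extension of a partial configuration by `false`. -/
def extendFalse {E : Type*} [DecidableEq E] (F : Finset E) (s : F → Bool) (e : E) : Bool :=
  if h : e ∈ F then s ⟨e, h⟩ else false

/-- The weight of a configuration on a finite set. -/
def configWeight {F : Type*} [Fintype F] (p : unitInterval) (s : F → Bool) : ℝ :=
  ∏ e, if s e then (p : ℝ) else 1 - p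

section

variable {E : Type*} {F F' : Finset E} {A B : Set (E → Bool)} (p : unitInterval)

theorem dependsOn_inter {F F' : Set E} (hA : DependsOn (· ∈ A) F) (hB : DependsOn (· ∈ B) F') :
    DependsOn (· ∈ A ∩ B) (F ∪ F') := by
  intro ω ω' h
  have h1 := hA fun i hi => h i (Or.inl hi)
  have h2 := hB fun i hi => h i (Or.inr hi)
  simp only [Set.mem_inter_iff] at *
  rw [h1, h2]

theorem dependsOn_biInter {ι : Type*} {s : Set ι} {C : ι → Set (E → Bool)} {F : ι → Set E}
    (h : ∀ i ∈ s, DependsOn (· ∈ C i) (F i)) :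
    DependsOn (· ∈ ⋂ i ∈ s, C i) (⋃ i ∈ s, F i) := by
  intro ω ω' hω
  simp only [Set.mem_iInter, eq_iff_iff]
  exact forall₂_congr fun i hi =>
    iff_of_eq (h i hi fun e he => hω e (Set.mem_biUnion hi he))

theorem mem_iff_extendFalse_mem [DecidableEq E] (hA : DependsOn (· ∈ A) (F : Set E))
    (ω : E → Bool) : ω ∈ A ↔ extendFalse F (F.restrict ω) ∈ A := by
  refine iff_of_eq (hA fun e he => ?_)
  simp [extendFalse, Finset.mem_coe.1 he]

theorem measurableSet_of_dependsOn (hA : DependsOn (· ∈ A) (F : Set E)) : MeasurableSet A := by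
  classical
  have : A = F.restrict ⁻¹' {s | extendFalse F s ∈ A} :=
    Set.ext fun ω => mem_iff_extendFalse_mem hA ω
  rw [this]
  exact Finset.measurable_restrict F (Set.toFinite _).measurableSet

/-- Such probabilities become polynomials in `p` and sums over a finite distributive lattice: the
first gives continuity, the second lets the FKG inequality apply. -/
theorem bernoulliProduct_real_eq_sum [DecidableEq E] (hA : DependsOn (· ∈ A) (F : Set E)) :
    (bernoulliProduct E p).real A =
      ∑ s : F → Bool, configWeight p s * {s | extendFalse F s ∈ A}.indicator 1 s := by
  classical
  have hAF : A = F.restrict ⁻¹' {s | extendFalse F s ∈ A} :=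
    Set.ext fun ω => mem_iff_extendFalse_mem hA ω
  have hm : MeasurableSet {s | extendFalse F s ∈ A} := (Set.toFinite _).measurableSet
  conv_lhs => rw [hAF]
  rw [← map_measureReal_apply (Finset.measurable_restrict F) hm,
    Measure.infinitePi_map_restrict]
  have h1 : {s | extendFalse F s ∈ A} =
      ((Finset.univ.filter fun s => extendFalse F s ∈ A : Finset (F → Bool)) :
        Set (F → Bool)) := by
    ext s; simp
  conv_lhs => rw [h1]
  rw [← sum_measureReal_singleton, Finset.sum_filter]
  refine Finset.sum_congr rfl fun s _ => ?_
  have h2 : (Measure.pi fun _ : F => bernoulliMeasure true false p).real {s} =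
      configWeight p s := by
    rw [measureReal_def, Measure.pi_singleton, ENNReal.toReal_prod]
    refine Finset.prod_congr rfl fun e _ => ?_
    rw [← measureReal_def]
    cases s e <;> simp
  simp [h2, Set.indicator_apply]

theorem continuous_bernoulliProduct_real (hA : DependsOn (· ∈ A) (F : Set E)) :
    Continuous fun p => (bernoulliProduct E p).real A := by
  classical
  simp_rw [bernoulliProduct_real_eq_sum _ hA, configWeight]
  refine continuous_finsetSum _ fun s _ => Continuous.mul ?_ continuous_const
  refine continuous_finsetProd _ fun e _ => ?_
  split_ifs <;> fun_prop

theorem configWeight_mul_le {F : Type*} [Fintype F] (a b : F → Bool) :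
    configWeight p a * configWeight p b ≤ configWeight p (a ⊓ b) * configWeight p (a ⊔ b) := by
  unfold configWeight
  rw [← Finset.prod_mul_distrib, ← Finset.prod_mul_distrib]
  refine le_of_eq (Finset.prod_congr rfl fun e _ => ?_)
  rw [Pi.inf_apply, Pi.sup_apply]
  cases a e <;> cases b e <;> simp [mul_comm]

/-- The **Harris inequality**: increasing events depending on finitely many coordinates are
positively correlated. -/
theorem bernoulliProduct_harris (hA : DependsOn (· ∈ A) (F : Set E))
    (hB : DependsOn (· ∈ B) (F' : Set E)) (hAu : IsUpperSet A) (hBu : IsUpperSet B) :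
    (bernoulliProduct E p).real A * (bernoulliProduct E p).real B ≤
      (bernoulliProduct E p).real (A ∩ B) := by
  classical
  have hA' : DependsOn (· ∈ A) ((F ∪ F' : Finset E) : Set E) := fun ω ω' h =>
    hA fun i hi => h i (by simp at hi; simp [hi])
  have hB' : DependsOn (· ∈ B) ((F ∪ F' : Finset E) : Set E) := fun ω ω' h =>
    hB fun i hi => h i (by simp at hi; simp [hi])
  have hAB : DependsOn (· ∈ A ∩ B) ((F ∪ F' : Finset E) : Set E) := by
    have := dependsOn_inter hA' hB'
    rwa [Set.union_self] at this
  have huniv : DependsOn (· ∈ (Set.univ : Set (E → Bool))) ((F ∪ F' : Finset E) : Set E) :=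
    fun ω ω' _ => by simp
  have h1 := bernoulliProduct_real_eq_sum p huniv
  rw [probReal_univ] at h1
  have hmono : ∀ {C : Set (E → Bool)}, IsUpperSet C →
      Monotone ({s | extendFalse (F ∪ F') s ∈ C}.indicator (1 : (↑(F ∪ F') → Bool) → ℝ)) := by
    intro C hC s t hst
    have hle : extendFalse (F ∪ F') s ≤ extendFalse (F ∪ F') t := by
      intro e
      unfold extendFalse
      split_ifs
      · exact hst _
      · exact le_rfl
    by_cases hs : extendFalse (F ∪ F') s ∈ C
    · simp [hs, hC hle hs]
    · simp only [Set.indicator_apply, Set.mem_ofPred_eq, hs, if_false]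
      split_ifs <;> simp
  have h := fkg (μ := configWeight p) (f := {s | extendFalse (F ∪ F') s ∈ A}.indicator 1)
    (g := {s | extendFalse (F ∪ F') s ∈ B}.indicator 1)
    (fun s => Finset.prod_nonneg fun e _ => by
      split_ifs
      exacts [p.2.1, sub_nonneg.2 p.2.2])
    (fun s => Set.indicator_nonneg (by simp) _) (fun s => Set.indicator_nonneg (by simp) _)
    (hmono hAu) (hmono hBu) (configWeight_mul_le p)
  rw [bernoulliProduct_real_eq_sum p hA', bernoulliProduct_real_eq_sum p hB',
    bernoulliProduct_real_eq_sum p hAB]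
  have h2 : ∑ s : ↑(F ∪ F') → Bool, configWeight p s = 1 := by simpa using h1.symm
  rw [h2, one_mul] at h
  refine h.trans (le_of_eq (Finset.sum_congr rfl fun s _ => ?_))
  by_cases h1 : extendFalse (F ∪ F') s ∈ A <;> by_cases h2 : extendFalse (F ∪ F') s ∈ B <;>
    simp [h1, h2]

theorem iIndepFun_bernoulliProduct :
    iIndepFun (fun (e : E) (ω : E → Bool) => ω e) (bernoulliProduct E p) := by
  rw [iIndepFun_iff_map_fun_eq_infinitePi_map (fun e => measurable_pi_apply e)]
  have h : ∀ e : E, (bernoulliProduct E p).map (fun ω => ω e) = bernoulliMeasure true false p :=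
    fun e => Measure.infinitePi_map_eval _ e
  simp_rw [h]
  exact Measure.map_id

/-- Events depending on disjoint finite sets of coordinates are independent. -/
theorem bernoulliProduct_inter (hA : DependsOn (· ∈ A) (F : Set E))
    (hB : DependsOn (· ∈ B) (F' : Set E)) (hF : Disjoint F F') :
    (bernoulliProduct E p).real (A ∩ B) =
      (bernoulliProduct E p).real A * (bernoulliProduct E p).real B := by
  classical
  have h := (iIndepFun_bernoulliProduct p (E := E)).indepFun_finset F F' hF
    (fun e => measurable_pi_apply e)
  have hAF : A = (fun ω (e : F) => ω e) ⁻¹' {s | extendFalse F s ∈ A} :=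
    Set.ext fun ω => mem_iff_extendFalse_mem hA ω
  have hBF : B = (fun ω (e : F') => ω e) ⁻¹' {s | extendFalse F' s ∈ B} :=
    Set.ext fun ω => mem_iff_extendFalse_mem hB ω
  have := h.measure_inter_preimage_eq_mul {s | extendFalse F s ∈ A} {s | extendFalse F' s ∈ B}
    (Set.toFinite _).measurableSet (Set.toFinite _).measurableSet
  rw [← hAF, ← hBF] at this
  simp only [measureReal_def, this, ENNReal.toReal_mul]

/-- Injectivity is enough for the relabelled coordinates to remain independent, so graph embeddings
can replace automorphisms. -/
theorem bernoulliProduct_map_comp {E' : Type*} {g : E → E'} (hg : Function.Injective g) :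
    (bernoulliProduct E' p).map (fun ω e => ω (g e)) = bernoulliProduct E p := by
  have h := (iIndepFun_bernoulliProduct p (E := E')).precomp hg
  rw [h.map_fun_eq_infinitePi_map fun e => measurable_pi_apply _]
  congr
  ext1 e
  exact Measure.infinitePi_map_eval _ (g e)

theorem bernoulliProduct_real_preimage {E' : Type*} {g : E → E'} (hg : Function.Injective g)
    (hA : MeasurableSet A) :
    (bernoulliProduct E' p).real ((fun ω e => ω (g e)) ⁻¹' A) = (bernoulliProduct E p).real A := by
  rw [← bernoulliProduct_map_comp p hg,
    map_measureReal_apply (measurable_pi_lambda _ fun e => measurable_pi_apply _) hA]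

theorem bernoulliProduct_zero : bernoulliProduct E 0 = Measure.dirac fun _ => false := by
  simp [bernoulliProduct]

end

/-! ### The second moment method on words. -/

theorem card_filter_agree {B : Type*} [Fintype B] {n j : ℕ} (w : Fin n → B)
    [DecidablePred fun w' : Fin n → B => ∀ i : Fin n, (i : ℕ) < j → w i = w' i] :
    (Finset.univ.filter fun w' : Fin n → B => ∀ i : Fin n, (i : ℕ) < j → w i = w' i).card =
      Fintype.card B ^ (n - j) := by
  classical
  have : (Finset.univ.filter fun w' : Fin n → B => ∀ i : Fin n, (i : ℕ) < j → w i = w' i) =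
      Fintype.piFinset fun i : Fin n => if (i : ℕ) < j then {w i} else Finset.univ := by
    ext w'
    simp only [Finset.mem_filter, Finset.mem_univ, true_and, Fintype.mem_piFinset]
    refine forall_congr' fun i => ?_
    split_ifs with h <;> simp [h, eq_comm]
  rw [this, Fintype.card_piFinset]
  have h2 : ∀ i : Fin n, (if (i : ℕ) < j then {w i} else (Finset.univ : Finset B)).card =
      if (i : ℕ) < j then 1 else Fintype.card B := by
    intro i
    split_ifs <;> simp [Finset.card_univ]
  simp_rw [h2]
  rw [Fin.prod_univ_eq_prod_range (fun i => if i < j then 1 else Fintype.card B) n,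
    Finset.prod_ite]
  simp only [Finset.prod_const_one, one_mul, Finset.prod_const]
  congr 1
  have : {x ∈ Finset.range n | ¬ x < j} = Finset.Ico j n := by
    ext x; simp; omega
  rw [this, Nat.card_Ico]

/-- The second moment bound for a weighted count of the events that occur. -/
theorem measureReal_iUnion_ge {Ω ι : Type*} [MeasurableSpace Ω] (P : Measure Ω)
    [IsProbabilityMeasure P] [Fintype ι] {A : ι → Set Ω} (hA : ∀ i, MeasurableSet (A i))
    (c : ι → ℝ) (t : ℝ) :
    2 * t * (∑ i, c i * P.real (A i)) - t ^ 2 * ∑ i, ∑ j, c i * c j * P.real (A i ∩ A j) ≤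
      P.real (⋃ i, A i) := by
  set Y : Ω → ℝ := fun ω => ∑ i, c i * (A i).indicator 1 ω with hY
  set Z : Ω → ℝ := fun ω => ∑ i, ∑ j, c i * c j * (A i ∩ A j).indicator 1 ω with hZ
  have hint : ∀ {s : Set Ω}, MeasurableSet s → Integrable (s.indicator (1 : Ω → ℝ)) P :=
    fun hs => (integrable_const (1 : ℝ)).indicator hs
  have hYi : Integrable Y P := integrable_finsetSum _ fun i _ => (hint (hA i)).const_mul _
  have hZi : Integrable Z P := integrable_finsetSum _ fun i _ => integrable_finsetSum _ fun j _ =>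
    (hint ((hA i).inter (hA j))).const_mul _
  have hYI : ∫ ω, Y ω ∂P = ∑ i, c i * P.real (A i) := by
    rw [integral_finsetSum _ fun i _ => (hint (hA i)).const_mul _]
    refine Finset.sum_congr rfl fun i _ => ?_
    rw [integral_const_mul, integral_indicator_one (hA i)]
  have hZI : ∫ ω, Z ω ∂P = ∑ i, ∑ j, c i * c j * P.real (A i ∩ A j) := by
    rw [integral_finsetSum _ fun i _ => integrable_finsetSum _ fun j _ =>
      (hint ((hA i).inter (hA j))).const_mul _]
    refine Finset.sum_congr rfl fun i _ => ?_
    rw [integral_finsetSum _ fun j _ => (hint ((hA i).inter (hA j))).const_mul _]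
    refine Finset.sum_congr rfl fun j _ => ?_
    rw [integral_const_mul, integral_indicator_one ((hA i).inter (hA j))]
  have hU : MeasurableSet (⋃ i, A i) := MeasurableSet.iUnion hA
  rw [← hYI, ← hZI, ← integral_indicator_one hU, ← integral_const_mul, ← integral_const_mul,
    ← integral_sub (hYi.const_mul _) (hZi.const_mul _)]
  refine integral_mono ((hYi.const_mul _).sub (hZi.const_mul _)) (hint hU) fun ω => ?_
  have hZY : Z ω = Y ω ^ 2 := by
    simp only [hY, hZ, sq, Finset.sum_mul_sum]
    refine Finset.sum_congr rfl fun i _ => Finset.sum_congr rfl fun j _ => ?_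
    rw [Set.inter_indicator_one, Pi.mul_apply]
    ring
  simp only [hZY]
  -- On the union, 2tY - t²Y² = 1 - (tY - 1)² ≤ 1; off it, Y vanishes.
  by_cases hω : ω ∈ ⋃ i, A i
  · rw [Set.indicator_of_mem hω, Pi.one_apply]
    nlinarith [sq_nonneg (t * Y ω - 1)]
  · have : Y ω = 0 := Finset.sum_eq_zero fun i _ => by
      rw [Set.indicator_of_notMem fun h => hω (Set.mem_iUnion.2 ⟨i, h⟩), mul_zero]
    simp [this, hω]

/-- Second moment method on a regular tree: events indexed by words of length `n`, with
correlations controlled by the length of a common prefix. -/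
theorem measureReal_iUnion_words_ge {Ω B : Type*} [MeasurableSpace Ω] (P : Measure Ω)
    [IsProbabilityMeasure P] [Fintype B] {n : ℕ} {A : (Fin n → B) → Set Ω}
    (hA : ∀ w, MeasurableSet (A w)) {C q : ℝ} (hC : 0 < C) (hq : 0 < q)
    (hbq : 1 < Fintype.card B * q) (hpos : ∀ w, 0 < P.real (A w))
    (h : ∀ w w', ∃ j ≤ n, (∀ i : Fin n, (i : ℕ) < j → w i = w' i) ∧
      P.real (A w ∩ A w') ≤ C * q⁻¹ ^ j * P.real (A w) * P.real (A w')) :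
    (1 - (Fintype.card B * q)⁻¹) / C ≤ P.real (⋃ w, A w) := by
  classical
  set b : ℝ := (Fintype.card B : ℝ) with hb
  set r : ℝ := (b * q)⁻¹ with hr
  have hbpos : 0 < b := pos_of_mul_pos_left (one_pos.trans hbq) hq.le
  have hr0 : 0 ≤ r := inv_nonneg.2 (one_pos.trans hbq).le
  have hr1 : r < 1 := inv_lt_one_of_one_lt₀ hbq
  have hrow : ∀ w, ∑ w', (P.real (A w))⁻¹ * (P.real (A w'))⁻¹ * P.real (A w ∩ A w') ≤
      C * b ^ n / (1 - r) := by
    intro w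
    -- Summing over all prefix lengths on which the words agree overcounts, but avoids choosing `j`
    -- for each pair; the result is still a geometric series in `r`.
    have hterm : ∀ w', (P.real (A w))⁻¹ * (P.real (A w'))⁻¹ * P.real (A w ∩ A w') ≤
        ∑ j ∈ Finset.range (n + 1),
          if ∀ i : Fin n, (i : ℕ) < j → w i = w' i then C * q⁻¹ ^ j else 0 := by
      intro w'
      obtain ⟨j, hj, hag, hle⟩ := h w w'
      have h1 := hpos w
      have h2 := hpos w'
      calc _ ≤ (P.real (A w))⁻¹ * (P.real (A w'))⁻¹ *
            (C * q⁻¹ ^ j * P.real (A w) * P.real (A w')) := by gcongr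
        _ = if ∀ i : Fin n, (i : ℕ) < j → w i = w' i then C * q⁻¹ ^ j else 0 := by
          rw [if_pos hag]
          field_simp
        _ ≤ _ := Finset.single_le_sum
          (f := fun j => if ∀ i : Fin n, (i : ℕ) < j → w i = w' i then C * q⁻¹ ^ j else 0)
          (fun j _ => by split_ifs <;> positivity)
          (Finset.mem_range.2 (Nat.lt_succ_of_le hj))
    calc _ ≤ ∑ w', ∑ j ∈ Finset.range (n + 1),
          (if ∀ i : Fin n, (i : ℕ) < j → w i = w' i then C * q⁻¹ ^ j else 0) :=
          Finset.sum_le_sum fun w' _ => hterm w'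
      _ = ∑ j ∈ Finset.range (n + 1), C * b ^ n * r ^ j := by
        rw [Finset.sum_comm]
        refine Finset.sum_congr rfl fun j hj => ?_
        have hj : j ≤ n := Nat.lt_succ_iff.1 (Finset.mem_range.1 hj)
        rw [← Finset.sum_filter, Finset.sum_const, card_filter_agree, nsmul_eq_mul,
          Nat.cast_pow, ← hb, hr, ← pow_sub_mul_pow b hj,
          mul_inv, mul_pow, inv_pow b]
        field_simp
      _ ≤ C * b ^ n * (1 - r)⁻¹ := by
        rw [← Finset.mul_sum]
        gcongr
        rw [← tsum_geometric_of_lt_one hr0 hr1]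
        exact (summable_geometric_of_lt_one hr0 hr1).sum_le_tsum _ fun _ _ => pow_nonneg hr0 _
      _ = _ := by rw [div_eq_mul_inv]
  have hcard : (Fintype.card (Fin n → B) : ℝ) = b ^ n := by simp [hb]
  have hsum : ∑ w, (P.real (A w))⁻¹ * P.real (A w) = b ^ n := by
    simp_rw [fun w => inv_mul_cancel₀ (hpos w).ne']
    simp [hb]
  have hS : ∑ w, ∑ w', (P.real (A w))⁻¹ * (P.real (A w'))⁻¹ * P.real (A w ∩ A w') ≤
      b ^ n * (C * b ^ n / (1 - r)) := by
    refine (Finset.sum_le_sum fun w _ => hrow w).trans (le_of_eq ?_)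
    rw [Finset.sum_const, Finset.card_univ, nsmul_eq_mul, hcard]
  have h1r : 0 < 1 - r := sub_pos.2 hr1
  have hbn : 0 < b ^ n := pow_pos hbpos n
  -- The weights give every word mean 1. The chosen `t` maximises 2 t bⁿ - t² b²ⁿ C / (1 - r).
  have hmain := measureReal_iUnion_ge P hA (fun w => (P.real (A w))⁻¹) ((1 - r) / (b ^ n * C))
  rw [hsum] at hmain
  refine le_trans ?_ hmain
  have h2 := mul_le_mul_of_nonneg_left hS (sq_nonneg ((1 - r) / (b ^ n * C)))
  have h3 : ((1 - r) / (b ^ n * C)) ^ 2 * (b ^ n * (C * b ^ n / (1 - r))) = (1 - r) / C := by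
    field_simp
  have h4 : 2 * ((1 - r) / (b ^ n * C)) * b ^ n = 2 * ((1 - r) / C) := by
    field_simp
  rw [h3] at h2
  rw [h4]
  linarith

/-! ### Correlations of chains of increasing events. -/

section Chain

variable {E B : Type*} (p : unitInterval) {H : ℕ → Set (E → Bool)} {F : ℕ → Finset E} {q : ℝ}

theorem dependsOn_biInter_finset [DecidableEq E] (hdep : ∀ m, DependsOn (· ∈ H m) (F m : Set E))
    (s : Finset ℕ) : DependsOn (· ∈ ⋂ m ∈ s, H m) (s.biUnion F : Set E) := by
  have := dependsOn_biInter (s := (s : Set ℕ)) (C := H) (F := fun m => (F m : Set E))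
    fun m _ => hdep m
  simpa using this

theorem isUpperSet_biInter_finset (hup : ∀ m, IsUpperSet (H m)) (s : Finset ℕ) :
    IsUpperSet (⋂ m ∈ s, H m) :=
  isUpperSet_iInter₂ fun m _ => hup m

theorem pow_card_le_bernoulliProduct_biInter (hdep : ∀ m, DependsOn (· ∈ H m) (F m : Set E))
    (hup : ∀ m, IsUpperSet (H m)) (hq : 0 ≤ q)
    (hprob : ∀ m, q ≤ (bernoulliProduct E p).real (H m)) (s : Finset ℕ) :
    q ^ s.card ≤ (bernoulliProduct E p).real (⋂ m ∈ s, H m) := by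
  classical
  induction s using Finset.induction_on with
  | empty => simp
  | insert a s ha ih =>
    rw [Finset.card_insert_of_notMem ha, pow_succ', Finset.set_biInter_insert]
    exact (mul_le_mul (hprob a) ih (pow_nonneg hq _) measureReal_nonneg).trans
      (bernoulliProduct_harris p (hdep a) (dependsOn_biInter_finset hdep s) (hup a)
        (isUpperSet_biInter_finset hup s))

/-- Correlation bound for two chains of events that become independent after index `l`. -/
theorem bernoulliProduct_chain_inter_le {H' : ℕ → Set (E → Bool)} {F' : ℕ → Finset E}
    (hdep : ∀ m, DependsOn (· ∈ H m) (F m : Set E))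
    (hdep' : ∀ m, DependsOn (· ∈ H' m) (F' m : Set E))
    (hup' : ∀ m, IsUpperSet (H' m)) (hq : 0 < q) (hq1 : q ≤ 1)
    (hprob' : ∀ m, q ≤ (bernoulliProduct E p).real (H' m)) {n l : ℕ}
    (hdisj : ∀ m m', l ≤ m' → Disjoint (F m) (F' m')) :
    (bernoulliProduct E p).real ((⋂ m ∈ Finset.range n, H m) ∩ ⋂ m ∈ Finset.range n, H' m) ≤
      q⁻¹ ^ l * (bernoulliProduct E p).real (⋂ m ∈ Finset.range n, H m) *
        (bernoulliProduct E p).real (⋂ m ∈ Finset.range n, H' m) := by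
  classical
  set s₀ := {m ∈ Finset.range n | m < l} with hs₀
  set s₁ := {m ∈ Finset.range n | ¬ m < l} with hs₁
  have hsplit : (⋂ m ∈ Finset.range n, H' m) = (⋂ m ∈ s₀, H' m) ∩ ⋂ m ∈ s₁, H' m := by
    ext ω
    simp only [hs₀, hs₁, Set.mem_inter_iff, Set.mem_iInter, Finset.mem_filter]
    exact ⟨fun h => ⟨fun m hm => h m hm.1, fun m hm => h m hm.1⟩,
      fun h m hm => (em (m < l)).elim (fun hl => h.1 m ⟨hm, hl⟩) fun hl => h.2 m ⟨hm, hl⟩⟩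
  have hcard : s₀.card ≤ l := by
    have : s₀ ⊆ Finset.range l := fun m hm => Finset.mem_range.2 (Finset.mem_filter.1 hm).2
    simpa using Finset.card_le_card this
  -- By Harris, requiring the at most `l` early events as well costs at most a factor `q ^ l`.
  have h1 : q ^ l * (bernoulliProduct E p).real (⋂ m ∈ s₁, H' m) ≤
      (bernoulliProduct E p).real (⋂ m ∈ Finset.range n, H' m) := by
    rw [hsplit]
    refine le_trans ?_ (bernoulliProduct_harris p (dependsOn_biInter_finset hdep' s₀)
      (dependsOn_biInter_finset hdep' s₁) (isUpperSet_biInter_finset hup' s₀)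
      (isUpperSet_biInter_finset hup' s₁))
    gcongr
    exact (pow_le_pow_of_le_one hq.le hq1 hcard).trans
      (pow_card_le_bernoulliProduct_biInter p hdep' hup' hq.le hprob' s₀)
  have h2 : (bernoulliProduct E p).real
      ((⋂ m ∈ Finset.range n, H m) ∩ ⋂ m ∈ Finset.range n, H' m) ≤
      (bernoulliProduct E p).real (⋂ m ∈ Finset.range n, H m) *
        (bernoulliProduct E p).real (⋂ m ∈ s₁, H' m) := by
    rw [← bernoulliProduct_inter p (dependsOn_biInter_finset hdep _)
      (dependsOn_biInter_finset hdep' s₁)]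
    · refine measureReal_mono (Set.inter_subset_inter_right _ ?_)
      rw [hsplit]
      exact Set.inter_subset_right
    · rw [Finset.disjoint_biUnion_left]
      intro m _
      rw [Finset.disjoint_biUnion_right]
      intro m' hm'
      exact hdisj m m' (not_lt.1 (Finset.mem_filter.1 hm').2)
  refine h2.trans ?_
  have h3 : (bernoulliProduct E p).real (⋂ m ∈ s₁, H' m) ≤
      q⁻¹ ^ l * (bernoulliProduct E p).real (⋂ m ∈ Finset.range n, H' m) := by
    rw [inv_pow, ← div_eq_inv_mul, le_div_iff₀' (pow_pos hq l)]
    exact h1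
  calc _ ≤ _ := mul_le_mul_of_nonneg_left h3 measureReal_nonneg
    _ = _ := by ring

end Chain

/-- If every vertex of a regular tree of chains passes to each child with probability at least `q`,
the branching number exceeds `1 / q`, and branches become independent a bounded time after they
separate, then with positive probability there are arbitrarily long chains. -/
theorem bernoulliProduct_chains_pos {E B : Type*} [Fintype B] (p : unitInterval)
    {H : (ℕ → B) → ℕ → Set (E → Bool)} {F : (ℕ → B) → ℕ → Finset E} {q : ℝ} {K : ℕ}
    (hdep : ∀ w m, DependsOn (· ∈ H w m) (F w m : Set E)) (hup : ∀ w m, IsUpperSet (H w m))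
    (hq : 0 < q) (hprob : ∀ w m, q ≤ (bernoulliProduct E p).real (H w m))
    (hloc : ∀ w w' m, (∀ i ≤ m, w i = w' i) → H w m = H w' m)
    (hdisj : ∀ w w' j, (∀ i < j, w i = w' i) → w j ≠ w' j →
      ∀ m m', j + K ≤ m' → Disjoint (F w m) (F w' m'))
    (hbq : 1 < Fintype.card B * q) :
    0 < bernoulliProduct E p {ω | ∀ n, ∃ w, ∀ m < n, ω ∈ H w m} := by
  classical
  have hB : Nonempty B := by
    by_contra hB
    rw [not_nonempty_iff] at hB
    simp at hbq
    linarith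
  obtain ⟨b₀⟩ := hB
  have hq1 : q ≤ 1 := (hprob (fun _ => b₀) 0).trans measureReal_le_one
  -- The padding letter is harmless: only events of index below `n` are used, and by `hloc` they
  -- read only the first `n` letters.
  let ext : (n : ℕ) → (Fin n → B) → ℕ → B := fun n w i => if h : i < n then w ⟨i, h⟩ else b₀
  let A : (n : ℕ) → (Fin n → B) → Set (E → Bool) :=
    fun n w => ⋂ m ∈ Finset.range n, H (ext n w) m
  have hA : ∀ n w, MeasurableSet (A n w) := fun n w =>
    measurableSet_of_dependsOn (dependsOn_biInter_finset (hdep (ext n w)) _)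
  have hApos : ∀ n w, q ^ n ≤ (bernoulliProduct E p).real (A n w) := fun n w => by
    have := pow_card_le_bernoulliProduct_biInter p (hdep (ext n w)) (hup _) hq.le (hprob _)
      (Finset.range n)
    rwa [Finset.card_range] at this
  have hpair : ∀ n (w w' : Fin n → B), ∃ j ≤ n, (∀ i : Fin n, (i : ℕ) < j → w i = w' i) ∧
      (bernoulliProduct E p).real (A n w ∩ A n w') ≤
        q⁻¹ ^ K * q⁻¹ ^ j * (bernoulliProduct E p).real (A n w) *
          (bernoulliProduct E p).real (A n w') := by
    intro n w w'
    -- Equal words take `j = n`, where `q⁻¹ ^ n` compensates the lower bound `q ^ n` on the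
    -- probability; distinct words take their first disagreement.
    by_cases hww : w = w'
    · subst hww
      refine ⟨n, le_rfl, fun _ _ => rfl, ?_⟩
      rw [Set.inter_self]
      refine le_mul_of_one_le_left measureReal_nonneg ?_
      calc (1 : ℝ) ≤ q⁻¹ ^ K := one_le_pow₀ (one_le_inv_iff₀.2 ⟨hq, hq1⟩)
        _ = q⁻¹ ^ K * q⁻¹ ^ n * q ^ n := by
          rw [mul_assoc, ← mul_pow, inv_mul_cancel₀ hq.ne', one_pow, mul_one]
        _ ≤ _ := by gcongr; exact hApos n w
    · have hex : ∃ j, ∃ h : j < n, w ⟨j, h⟩ ≠ w' ⟨j, h⟩ := by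
        obtain ⟨i, hi⟩ := Function.ne_iff.1 hww
        exact ⟨i, i.2, hi⟩
      obtain ⟨hjn, hj⟩ := Nat.find_spec hex
      set j := Nat.find hex with hjdef
      have hag : ∀ i : Fin n, (i : ℕ) < j → w i = w' i := by
        intro i hi
        have := Nat.find_min hex hi
        push Not at this
        exact this i.2
      refine ⟨j, hjn.le, hag, ?_⟩
      have hext : ∀ i < j, ext n w i = ext n w' i := by
        intro i hi
        have hin := hi.trans hjn
        simp only [ext, hin, dif_pos]
        exact hag ⟨i, hin⟩ hi
      have hextj : ext n w j ≠ ext n w' j := by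
        simpa only [ext, hjn, dif_pos] using hj
      have := bernoulliProduct_chain_inter_le p (hdep (ext n w)) (hdep (ext n w'))
        (hup _) hq hq1 (hprob _) (n := n) (l := j + K) (hdisj _ _ j hext hextj)
      rwa [pow_add, mul_comm (q⁻¹ ^ j)] at this
  set δ : ℝ := (1 - (Fintype.card B * q)⁻¹) / q⁻¹ ^ K with hδ
  have hδpos : 0 < δ := div_pos (sub_pos.2 (inv_lt_one_of_one_lt₀ hbq)) (by positivity)
  have hbound : ∀ n, δ ≤ (bernoulliProduct E p).real (⋃ w, A n w) := fun n =>
    measureReal_iUnion_words_ge _ (hA n) (by positivity) hq hbq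
      (fun w => (pow_pos hq n).trans_le (hApos n w)) (hpair n)
  have hU : ∀ n, (⋃ w, A n w) = {ω | ∃ w, ∀ m < n, ω ∈ H w m} := by
    intro n
    ext ω
    simp only [A, Set.mem_iUnion, Set.mem_iInter, Finset.mem_range, Set.mem_ofPred_eq]
    constructor
    · rintro ⟨w, hw⟩
      exact ⟨_, hw⟩
    · rintro ⟨w, hw⟩
      refine ⟨fun i => w i, fun m hm => ?_⟩
      rw [hloc _ w m fun i hi => by simp [ext, hi.trans_lt hm]]
      exact hw m hm
  have hset : {ω | ∀ n, ∃ w, ∀ m < n, ω ∈ H w m} = ⋂ n, ⋃ w, A n w := by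
    ext ω
    simp only [hU, Set.mem_iInter, Set.mem_ofPred_eq]
  have hanti : Antitone fun n => ⋃ w, A n w := by
    intro n n' hnn ω hω
    simp only [hU] at hω ⊢
    obtain ⟨w, hw⟩ := hω
    exact ⟨w, fun m hm => hw m (hm.trans_le hnn)⟩
  have hlim := tendsto_measure_iInter_atTop (μ := bernoulliProduct E p)
    (fun n => (MeasurableSet.iUnion (hA n)).nullMeasurableSet) hanti ⟨0, measure_ne_top _ _⟩
  rw [hset]
  refine (ENNReal.ofReal_pos.2 hδpos).trans_le (ge_of_tendsto' hlim fun n => ?_)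
  exact ENNReal.ofReal_le_of_le_toReal (hbound n)

/-! ### Connections inside finite edge sets. -/

namespace Percolation

section General

variable {V : Type*} {G : SimpleGraph V}

theorem openSubgraph_mono {ω ω' : G.edgeSet → Bool} (h : ω ≤ ω') :
    openSubgraph G ω ≤ openSubgraph G ω' := by
  rintro x y ⟨hadj, hω⟩
  exact ⟨hadj, le_antisymm (Bool.le_true _) (hω ▸ h ⟨s(x, y), hadj⟩)⟩

open Classical in
/-- The configuration in which all edges outside `F` have been closed. -/
noncomputable def closeOutside (F : Finset G.edgeSet) (ω : G.edgeSet → Bool) (e : G.edgeSet) :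
    Bool :=
  if e ∈ F then ω e else false

theorem closeOutside_le (F : Finset G.edgeSet) (ω : G.edgeSet → Bool) : closeOutside F ω ≤ ω := by
  intro e
  unfold closeOutside
  split_ifs
  · exact le_rfl
  · exact Bool.false_le _

theorem closeOutside_mono {F F' : Finset G.edgeSet} (hF : F ⊆ F') {ω ω' : G.edgeSet → Bool}
    (h : ω ≤ ω') : closeOutside F ω ≤ closeOutside F' ω' := by
  intro e
  unfold closeOutside
  split_ifs with h1 h2
  · exact h e
  · exact absurd (hF h1) h2
  · exact Bool.false_le _
  · exact le_rfl

/-- The event that `x` and `y` are joined by an open path using only edges of `F`. -/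
def connectedIn (F : Finset G.edgeSet) (x y : V) : Set (G.edgeSet → Bool) :=
  {ω | y ∈ cluster G (closeOutside F ω) x}

theorem dependsOn_connectedIn (F : Finset G.edgeSet) (x y : V) :
    DependsOn (· ∈ connectedIn F x y) (F : Set G.edgeSet) := by
  intro ω ω' h
  have : closeOutside F ω = closeOutside F ω' := by
    funext e
    unfold closeOutside
    split_ifs with he
    · exact h e he
    · rfl
  simp only [connectedIn, Set.mem_ofPred_eq, this]

theorem isUpperSet_connectedIn (F : Finset G.edgeSet) (x y : V) :
    IsUpperSet (connectedIn F x y) := fun _ _ h hω =>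
  SimpleGraph.Reachable.mono (openSubgraph_mono (closeOutside_mono subset_rfl h)) hω

theorem connectedIn_mono (x y : V) : Monotone fun F : Finset G.edgeSet => connectedIn F x y :=
  fun _ _ h _ hω => SimpleGraph.Reachable.mono (openSubgraph_mono (closeOutside_mono h le_rfl)) hω

theorem setOf_mem_cluster_eq_iUnion (x y : V) :
    {ω | y ∈ cluster G ω x} = ⋃ F : Finset G.edgeSet, connectedIn F x y := by
  classical
  ext ω
  rw [Set.mem_iUnion]
  constructor
  · rintro ⟨p⟩
    induction p with
    | nil => exact ⟨∅, SimpleGraph.Reachable.refl _⟩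
    | @cons u v w h p ih =>
      obtain ⟨F, hF⟩ := ih
      obtain ⟨hadj, hω⟩ := h
      refine ⟨insert ⟨s(u, v), hadj⟩ F, ?_⟩
      have h1 : (openSubgraph G (closeOutside (insert ⟨s(u, v), hadj⟩ F) ω)).Adj u v :=
        ⟨hadj, by simp [closeOutside, hω]⟩
      exact h1.reachable.trans (connectedIn_mono _ _ (Finset.subset_insert _ F) hF)
  · rintro ⟨F, hF⟩
    exact SimpleGraph.Reachable.mono (openSubgraph_mono (closeOutside_le F ω)) hF

/-- An open path uses finitely many edges, so the connection event is a directed union of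
finite-range ones. Countability of the edges gives continuity from below. -/
theorem twoPoint_le_of_forall_connectedIn_le [Countable V] {p : unitInterval} {x y : V} {c : ℝ}
    (hc : 0 ≤ c) (h : ∀ F, (bondMeasure G p).real (connectedIn F x y) ≤ c) :
    twoPoint G p x y ≤ c := by
  have : Countable G.edgeSet := by
    have : Countable (Sym2 V) := inferInstanceAs (Countable (Quot (Sym2.Rel V)))
    infer_instance
  have : IsProbabilityMeasure (bondMeasure G p) := by unfold bondMeasure; infer_instance
  unfold twoPoint
  refine ENNReal.toReal_le_of_le_ofReal hc ?_
  rw [setOf_mem_cluster_eq_iUnion, (connectedIn_mono x y).directed_le.measure_iUnion]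
  exact iSup_le fun F => (ENNReal.le_ofReal_iff_toReal_le (measure_ne_top _ _) hc).2 (h F)

theorem mem_cluster_of_comap_mem_connectedIn (f : G →g G) {F : Finset G.edgeSet} {x y : V}
    {ω : G.edgeSet → Bool} (h : (fun e => ω (f.mapEdgeSet e)) ∈ connectedIn F x y) :
    f y ∈ cluster G ω (f x) := by
  have h1 : y ∈ cluster G (fun e => ω (f.mapEdgeSet e)) x :=
    SimpleGraph.Reachable.mono (openSubgraph_mono (closeOutside_le F _)) h
  let g : openSubgraph G (fun e => ω (f.mapEdgeSet e)) →g openSubgraph G ω :=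
    ⟨f, fun {a b} ⟨hadj, hω⟩ => ⟨f.map_rel hadj, hω⟩⟩
  exact SimpleGraph.Reachable.map g h1

theorem twoPoint_zero_of_ne {x y : V} (h : x ≠ y) (F : Finset G.edgeSet) :
    (bondMeasure G 0).real (connectedIn F x y) = 0 := by
  have h1 : bondMeasure G 0 = Measure.dirac fun _ => false := bernoulliProduct_zero
  have h2 : (fun _ => false) ∉ connectedIn F x y := by
    rintro ⟨p⟩
    cases p with
    | nil => exact h rfl
    | cons hadj p =>
      obtain ⟨hadj, hω⟩ := hadj
      simp [closeOutside] at hω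
  rw [h1, measureReal_def, Measure.dirac_apply' _
    (measurableSet_of_dependsOn (dependsOn_connectedIn F x y))]
  simp [h2]

end General

/-! ### Embeddings of the Cartesian product. -/

section Product

variable {ι : Type*} {V : ι → Type*} {T : ∀ i, SimpleGraph (V i)}

/-- A family of isometric embeddings acts on the Cartesian product. -/
def productHom (φ : ∀ i, V i → V i) (hφ : ∀ i a b, (T i).dist (φ i a) (φ i b) = (T i).dist a b) :
    cartesianProduct T →g cartesianProduct T where
  toFun z i := φ i (z i)
  map_rel' := by
    rintro z z' ⟨i, hi, hij⟩
    refine ⟨i, ?_, fun j hj => congrArg (φ j) (hij j hj)⟩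
    rw [← SimpleGraph.dist_eq_one_iff_adj, hφ, SimpleGraph.dist_eq_one_iff_adj]
    exact hi

theorem exists_productHom [∀ i, (T i).LocallyFinite] {k : ι → ℕ} (htree : ∀ i, (T i).IsTree)
    (hreg : ∀ i, (T i).IsRegularOfDegree (k i)) {x y u v : ∀ i, V i}
    (h : ∀ i, (T i).dist (x i) (y i) = (T i).dist (u i) (v i)) :
    ∃ f : cartesianProduct T →g cartesianProduct T, f x = u ∧ f y = v ∧
      ∀ z z' i, (T i).dist (f z i) (f z' i) = (T i).dist (z i) (z' i) := by
  have hex := fun i => (htree i).exists_isometry (htree i)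
    (fun a b => by rw [(hreg i).degree_eq, (hreg i).degree_eq]) (h i)
  choose φ hx hy hφ using hex
  exact ⟨productHom φ hφ, funext hx, funext hy, fun z z' i => hφ i _ _⟩

theorem hom_injective_of_dist (htree : ∀ i, (T i).IsTree)
    {f : cartesianProduct T →g cartesianProduct T}
    (hf : ∀ z z' i, (T i).dist (f z i) (f z' i) = (T i).dist (z i) (z' i)) :
    Function.Injective f := by
  intro z z' h
  funext i
  have := hf z z' i
  rw [h, SimpleGraph.dist_self, eq_comm, (htree i).connected.dist_eq_zero_iff] at this
  exact this

/-- In direction `i` each copy of `F` stays within `R` of its base point, so an edge common to both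
copies would put the base points within `2 * R`. -/
theorem disjoint_image_mapEdgeSet [DecidableEq (cartesianProduct T).edgeSet]
    (htree : ∀ i, (T i).IsTree) {f f' : cartesianProduct T →g cartesianProduct T}
    (hf : ∀ z z' i, (T i).dist (f z i) (f z' i) = (T i).dist (z i) (z' i))
    (hf' : ∀ z z' i, (T i).dist (f' z i) (f' z' i) = (T i).dist (z i) (z' i))
    {F : Finset (cartesianProduct T).edgeSet} {x : ∀ i, V i} {R : ℕ} {i : ι}
    (hR : ∀ e ∈ F, ∀ z ∈ e.1, (T i).dist (z i) (x i) ≤ R)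
    (hfar : 2 * R < (T i).dist (f x i) (f' x i)) :
    Disjoint (F.image f.mapEdgeSet) (F.image f'.mapEdgeSet) := by
  rw [Finset.disjoint_left]
  intro e he he'
  obtain ⟨e₁, he₁, rfl⟩ := Finset.mem_image.1 he
  obtain ⟨e₂, he₂, heq⟩ := Finset.mem_image.1 he'
  have heq' : e₂.1.map f' = e₁.1.map f := congrArg Subtype.val heq
  obtain ⟨z, hz⟩ : ∃ z, z ∈ e₁.1 := ⟨_, Sym2.out_fst_mem e₁.1⟩
  have hfz : f z ∈ e₂.1.map f' := heq' ▸ Sym2.mem_map.2 ⟨z, hz, rfl⟩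
  obtain ⟨z', hz', hzz⟩ := Sym2.mem_map.1 hfz
  have h1 := hR e₁ he₁ z hz
  have h2 := hR e₂ he₂ z' hz'
  rw [← hf] at h1
  rw [← hf', hzz] at h2
  have h3 := (htree i).connected.dist_triangle (u := f x i) (v := f z i) (w := f' x i)
  rw [SimpleGraph.dist_comm] at h1
  omega

end Product

end Percolation

/-! ### The branching structure indexed by words. -/

namespace Percolation

/-- The vertex reached from `x` after reading the first letters of the word `w`. -/
def wordVertex {V B : Type*} (step : V → B → V) (x : V) (w : ℕ → B) : ℕ → V
  | 0 => x
  | m + 1 => step (wordVertex step x w m) (w m)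

theorem wordVertex_congr {V B : Type*} (step : V → B → V) (x : V) {w w' : ℕ → B} {m : ℕ}
    (h : ∀ i < m, w i = w' i) : wordVertex step x w m = wordVertex step x w' m := by
  induction m with
  | zero => rfl
  | succ m ih =>
    rw [wordVertex, wordVertex, ih fun i hi => h i (hi.trans m.lt_succ_self), h m m.lt_succ_self]

section Words

variable {ι : Type*} {V : ι → Type*} {T : ∀ i, SimpleGraph (V i)} {B : Type*}
  {step : (∀ i, V i) → B → ∀ i, V i} {x : ∀ i, V i} {a : ι → ℕ}

theorem isDescendant_wordVertex (htree : ∀ i, (T i).IsTree)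
    (hstep : ∀ u β i, (T i).IsDescendant (x i) (u i) (step u β i) ∧
      (T i).dist (step u β i) (u i) = a i) (w : ℕ → B) (m l : ℕ) (i : ι) :
    (T i).IsDescendant (x i) (wordVertex step x w m i) (wordVertex step x w (m + l) i) ∧
      (T i).dist (wordVertex step x w (m + l) i) (wordVertex step x w m i) = l * a i := by
  induction l with
  | zero => simp [SimpleGraph.IsDescendant.refl]
  | succ l ih =>
    have h := hstep (wordVertex step x w (m + l)) (w (m + l)) i
    have h2 := ih.1.trans (htree i).connected h.1
    rw [ih.2, h.2] at h2
    refine ⟨h2.1, h2.2.trans ?_⟩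
    ring

/-- Two branches that separate at time `j` in the direction `i` are at distance at least linear
in the time elapsed since. -/
theorem lt_dist_wordVertex (htree : ∀ i, (T i).IsTree)
    (hstep : ∀ u β i, (T i).IsDescendant (x i) (u i) (step u β i) ∧
      (T i).dist (step u β i) (u i) = a i) {w w' : ℕ → B} {j : ℕ} (hag : ∀ i < j, w i = w' i)
    {i : ι} (ha : 1 ≤ a i)
    (hne : wordVertex step x w (j + 1) i ≠ wordVertex step x w' (j + 1) i) (m : ℕ) {l : ℕ} :
    l < (T i).dist (wordVertex step x w m i) (wordVertex step x w' (j + 1 + l) i) := by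
  -- For `m ≤ j` the first vertex is an ancestor of the second on the same branch; for `m > j` the
  -- two descend from distinct vertices of generation `(j + 1) * a i`.
  rcases le_or_gt m j with hm | hm
  · rw [wordVertex_congr step x fun i hi => hag i (hi.trans_le hm), SimpleGraph.dist_comm]
    obtain ⟨c, rfl⟩ := Nat.exists_eq_add_of_le hm
    have h := (isDescendant_wordVertex htree hstep w' m (c + 1 + l) i).2
    rw [show m + c + 1 + l = m + (c + 1 + l) by ring, h]
    calc l < c + 1 + l := by omega
      _ ≤ (c + 1 + l) * a i := Nat.le_mul_of_pos_right _ ha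
  · obtain ⟨c, rfl⟩ := Nat.exists_eq_add_of_le (Nat.succ_le_of_lt hm)
    have h1 := isDescendant_wordVertex htree hstep w (j + 1) c i
    have h2 := isDescendant_wordVertex htree hstep w' (j + 1) l i
    have h3 := (isDescendant_wordVertex htree hstep w 0 (j + 1) i).2
    have h4 := (isDescendant_wordVertex htree hstep w' 0 (j + 1) i).2
    rw [zero_add] at h3 h4
    have h5 := (htree i).dist_lt_dist_of_isDescendant h2.1 h1.1 (h4.trans h3.symm) hne.symm
    rw [h2.2, SimpleGraph.dist_comm] at h5
    exact (Nat.le_mul_of_pos_right _ ha).trans_lt h5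

end Words

/-- If the probability of a finite-range connection from `x` to `y` exceeds
`∏ (kᵢ - 1) ^ (-dᵢ(xᵢ, yᵢ))`, then there is percolation. -/
theorem infinite_cluster_of_one_lt {ι : Type*} [Fintype ι] {V : ι → Type*}
    {T : ∀ i, SimpleGraph (V i)} [∀ i, (T i).LocallyFinite] {k : ι → ℕ}
    (htree : ∀ i, (T i).IsTree) (hreg : ∀ i, (T i).IsRegularOfDegree (k i)) (hk : ∀ i, 1 ≤ k i)
    {x y : ∀ i, V i} (hxy : x ≠ y) (p : unitInterval) (F₀ : Finset (cartesianProduct T).edgeSet)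
    (h : 1 < (∏ i, ((k i - 1 : ℕ) : ℝ) ^ (T i).dist (x i) (y i)) *
      (bondMeasure (cartesianProduct T) p).real (connectedIn F₀ x y)) :
    0 < bondMeasure (cartesianProduct T) p
      {ω | ∃ x, (cluster (cartesianProduct T) ω x).Infinite} := by
  classical
  set a : ι → ℕ := fun i => (T i).dist (x i) (y i) with ha
  set B := ∀ i, Fin ((k i - 1) ^ a i) with hB
  have hdesc := fun i (u : V i) => (htree i).exists_descendants (k := k i - 1)
    (fun v => by rw [(hreg i).degree_eq]; exact (Nat.sub_add_cancel (hk i)).le) (x i) u (a i)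
  choose s hs hs' using hdesc
  let step : (∀ i, V i) → B → ∀ i, V i :=
    fun u β i => ((s i (u i)).equivFinOfCardEq (hs i (u i))).symm (β i)
  have hstep : ∀ u β i, (T i).IsDescendant (x i) (u i) (step u β i) ∧
      (T i).dist (step u β i) (u i) = a i := fun u β i => hs' i (u i) _ (Subtype.prop _)
  have hstep_inj : ∀ u β β' i, step u β i = step u β' i → β i = β' i := fun u β β' i hββ =>
    ((s i (u i)).equivFinOfCardEq (hs i (u i))).symm.injective (Subtype.ext hββ)
  have hf := fun (u : ∀ i, V i) (β : B) => exists_productHom htree hreg (x := x) (y := y) (u := u)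
    (v := step u β) fun i => by rw [SimpleGraph.dist_comm (u := u i), (hstep u β i).2]
  choose f hfx hfy hfd using hf
  obtain ⟨R, hR⟩ : ∃ R : ℕ, ∀ e ∈ F₀, ∀ z : ∀ i, V i, z ∈ e.1 → ∀ i, (T i).dist (z i) (x i) ≤ R := by
    have hfin : (⋃ e ∈ F₀, {z : ∀ i, V i | z ∈ e.1}).Finite := by
      refine F₀.finite_toSet.biUnion fun e _ => ?_
      exact (e.1.toFinset.finite_toSet).subset fun z hz => by simpa using hz
    refine ⟨∑ z ∈ (hfin.toFinset : Finset (∀ i, V i)), ∑ i, (T i).dist (z i) (x i), fun e he z hz i => ?_⟩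
    refine le_trans (Finset.single_le_sum (f := fun i => (T i).dist (z i) (x i))
      (fun _ _ => Nat.zero_le _) (Finset.mem_univ i)) ?_
    refine Finset.single_le_sum (f := fun z : ∀ i, V i => ∑ i, (T i).dist (z i) (x i))
      (fun _ _ => Nat.zero_le _) ?_
    simp only [Set.Finite.mem_toFinset, Set.mem_iUnion]
    exact ⟨e, he, hz⟩
  let X : (ℕ → B) → ℕ → ∀ i, V i := wordVertex step x
  let g : (ℕ → B) → ℕ → (cartesianProduct T →g cartesianProduct T) := fun w m => f (X w m) (w m)
  let H : (ℕ → B) → ℕ → Set ((cartesianProduct T).edgeSet → Bool) :=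
    fun w m => (fun ω e => ω ((g w m).mapEdgeSet e)) ⁻¹' connectedIn F₀ x y
  have hpos : 0 < (bondMeasure (cartesianProduct T) p).real (connectedIn F₀ x y) := by
    refine pos_of_mul_pos_right (one_pos.trans h) ?_
    exact Finset.prod_nonneg fun i _ => pow_nonneg (Nat.cast_nonneg _) _
  have hcard : (Fintype.card B : ℝ) = ∏ i, ((k i - 1 : ℕ) : ℝ) ^ (T i).dist (x i) (y i) := by
    simp [hB, ha]
  -- `K = 2 * R + 1`: branches differing at letter `j` occupy distinct vertices from time `j + 1`,
  -- and `2 * R` further steps put the base points more than `2 * R` apart.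
  have hmain := bernoulliProduct_chains_pos p (H := H)
    (F := fun w m => F₀.image (g w m).mapEdgeSet) (K := 2 * R + 1)
    (q := (bondMeasure (cartesianProduct T) p).real (connectedIn F₀ x y))
    (fun w m ω ω' hω => dependsOn_connectedIn F₀ x y fun e he =>
      hω _ (Finset.mem_coe.2 (Finset.mem_image_of_mem _ he)))
    (fun w m ω ω' hωω hω => isUpperSet_connectedIn F₀ x y (fun e => hωω _) hω)
    hpos
    (fun w m => (bernoulliProduct_real_preimage p
      (SimpleGraph.Hom.mapEdgeSet.injective _ (hom_injective_of_dist htree (hfd _ _)))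
      (measurableSet_of_dependsOn (dependsOn_connectedIn F₀ x y))).ge)
    (fun w w' m hww => by
      have : g w m = g w' m := by
        simp only [g, X]
        rw [wordVertex_congr step x fun i hi => hww i hi.le, hww m le_rfl]
      simp only [H, this])
    (fun w w' j hag hne m m' hm' => by
      obtain ⟨i, hi⟩ := Function.ne_iff.1 hne
      have hai : 1 ≤ a i := by
        by_contra! hai
        have : Subsingleton (Fin ((k i - 1) ^ a i)) := by
          rw [Nat.lt_one_iff.1 hai, pow_zero]
          infer_instance
        exact hi (Subsingleton.elim _ _)
      refine disjoint_image_mapEdgeSet htree (hfd _ _) (hfd _ _) (R := R) (i := i)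
        (fun e he z hz => hR e he z hz i) ?_
      rw [hfx, hfx]
      obtain ⟨c, rfl⟩ := Nat.exists_eq_add_of_le hm'
      rw [show j + (2 * R + 1) + c = j + 1 + (2 * R + c) by ring]
      refine lt_of_le_of_lt (Nat.le_add_right _ c) (lt_dist_wordVertex htree hstep hag hai ?_ m)
      intro heq
      rw [wordVertex, wordVertex, wordVertex_congr step x hag] at heq
      exact hi (hstep_inj _ _ _ _ heq))
    (by rw [hcard]; exact h)
  refine hmain.trans_le (measure_mono ?_)
  intro ω hω
  refine ⟨x, fun hfin => ?_⟩
  -- Along a chain the distance to `x i` grows by `a i ≥ 1` per step, so `n + 1` steps exceed any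
  -- bound `n` valid on a finite cluster.
  obtain ⟨i, hi⟩ := Function.ne_iff.1 hxy
  have hai : 1 ≤ a i := (htree i).connected.pos_dist_of_ne hi
  obtain ⟨n, hn⟩ := (hfin.image fun z => (T i).dist (z i) (x i)).bddAbove
  obtain ⟨w, hw⟩ := hω (n + 1)
  have hchain : ∀ m ≤ n + 1, X w m ∈ cluster (cartesianProduct T) ω x := by
    intro m
    induction m with
    | zero => exact fun _ => SimpleGraph.Reachable.refl _
    | succ m ih =>
      intro hm
      have h1 := mem_cluster_of_comap_mem_connectedIn (g w m) (hw m hm)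
      have h2 : g w m x = X w m := hfx _ _
      have h3 : g w m y = X w (m + 1) := hfy _ _
      rw [h2, h3] at h1
      exact SimpleGraph.Reachable.trans (ih (by omega)) h1
  have h1 := hn (Set.mem_image_of_mem _ (hchain (n + 1) le_rfl))
  have h2 := (isDescendant_wordVertex htree hstep w 0 (n + 1) i).2
  rw [zero_add] at h2
  have h3 : (n + 1) * a i ≤ n := h2 ▸ h1
  nlinarith

end Percolation

/-! ### Passage to the critical point. -/

theorem theorem1p3 (N : ℕ) (V : Fin N → Type*) (T : ∀ i, SimpleGraph (V i))
    [∀ i, (T i).LocallyFinite] (k : Fin N → ℕ)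
    (htree : ∀ i, (T i).IsTree)
    (hreg : ∀ i, (T i).IsRegularOfDegree (k i))
    (hk : ∀ i, 3 ≤ k i)
    (x y : ∀ i, V i) :
    Percolation.twoPoint (Percolation.cartesianProduct T)
        (Percolation.criticalProb (Percolation.cartesianProduct T)) x y ≤
      ∏ i, ((k i : ℝ) - 1) ^ (-((T i).dist (x i) (y i) : ℤ)) ∧
    ∏ i, ((k i : ℝ) - 1) ^ (-((T i).dist (x i) (y i) : ℤ)) =
      Real.exp (-∑ i, Real.log ((k i : ℝ) - 1) * ((T i).dist (x i) (y i) : ℝ)) := by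
  have hk1 : ∀ i, (0 : ℝ) < (k i : ℝ) - 1 := fun i => by
    have : (3 : ℝ) ≤ k i := by exact_mod_cast hk i
    linarith
  constructor
  · have hcount : ∀ i, Countable (V i) := fun i => (htree i).connected.countable
    have hk2 : ∀ i, ((k i - 1 : ℕ) : ℝ) = (k i : ℝ) - 1 := fun i => by
      rw [Nat.cast_sub (by have := hk i; omega), Nat.cast_one]
    set b : ℝ := ∏ i, ((k i - 1 : ℕ) : ℝ) ^ (T i).dist (x i) (y i) with hb
    have hbpos : 0 < b := Finset.prod_pos fun i _ => pow_pos (by rw [hk2]; exact hk1 i) _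
    have hbinv : ∏ i, ((k i : ℝ) - 1) ^ (-((T i).dist (x i) (y i) : ℤ)) = b⁻¹ := by
      rw [hb, ← Finset.prod_inv_distrib]
      refine Finset.prod_congr rfl fun i _ => ?_
      rw [hk2, zpow_neg, zpow_natCast]
    rw [hbinv]
    by_cases hxy : x = y
    · subst hxy
      have : b = 1 := by simp [hb]
      rw [this, inv_one]
      exact Percolation.twoPoint_le_of_forall_connectedIn_le zero_le_one fun F =>
        (measureReal_le_one : (bernoulliProduct _ _).real _ ≤ 1)
    refine Percolation.twoPoint_le_of_forall_connectedIn_le (inv_nonneg.2 hbpos.le) fun F => ?_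
    set pc := Percolation.criticalProb (Percolation.cartesianProduct T) with hpc
    have hsub : ∀ p < pc,
        (Percolation.bondMeasure (Percolation.cartesianProduct T) p).real
          (Percolation.connectedIn F x y) ≤ b⁻¹ := by
      intro p hp
      by_contra! hlt
      refine notMem_of_lt_csInf' hp (Percolation.infinite_cluster_of_one_lt htree hreg
        (fun i => by have := hk i; omega) hxy p F ?_)
      rwa [← inv_lt_iff_one_lt_mul₀' hbpos]
    -- At `pc = 0` there is no smaller `p` to approximate from, but all edges are closed there;
    -- otherwise `pc` is a limit of smaller parameters.
    rcases eq_or_ne pc 0 with h0 | h0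
    · rw [h0, Percolation.twoPoint_zero_of_ne hxy]
      exact inv_nonneg.2 hbpos.le
    · have hclosed : IsClosed {p | (Percolation.bondMeasure (Percolation.cartesianProduct T) p).real
          (Percolation.connectedIn F x y) ≤ b⁻¹} :=
        isClosed_le (continuous_bernoulliProduct_real (Percolation.dependsOn_connectedIn F x y))
          continuous_const
      have hmem : pc ∈ closure (Set.Iio pc) := by
        rw [closure_Iio' (a := pc) ⟨0, unitInterval.pos_iff_ne_zero.2 h0⟩]
        exact Set.self_mem_Iic
      exact closure_minimal (fun p hp => hsub p hp) hclosed hmem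
  · rw [← Finset.sum_neg_distrib, Real.exp_sum]
    refine Finset.prod_congr rfl fun i _ => ?_
    rw [zpow_neg, zpow_natCast, Real.exp_neg, mul_comm, Real.exp_nat_mul, Real.exp_log (hk1 i)]
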